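/- Let $m\ge 2$ and $\mathcal T=\{0,\frac1{m-1},\dots,1\}$ with $\sim a=1-a$, $a\to b=\min\{1,1-a+b\}$, $a\odot b=\max\{0,a+b-1\}$. Formulae are built from propositional variables $p_0,p_1,\dots$ by $\neg,\to,\succ$. Put $\mathbf t=p_0\to p_0$, $\phi\vee\psi=(\phi\to\psi)\to\psi$, $\phi\wedge\psi=\neg(\neg\phi\vee\neg\psi)$, $\phi\leftrightarrow\psi=(\phi\to\psi)\wedge(\psi\to\phi)$, $\phi\odot\psi=\neg(\phi\to\neg\psi)$; $\phi^k$ is the $\odot$-power; $\to_{i=1}^{k}(\phi_i,\psi)$ is $\phi_k\to(\cdots\to(\phi_1\to\psi))$. The operators $J_a$ ($a\in\mathcal T$) are: $J_1(\phi)=\phi^{m-1}$; for $\frac12\le a<1$ and $k$ the largest integer with $k(1-a)<1$, $J_a(\phi)=J_1(\neg\phi^k\leftrightarrow\phi)$ if $k(1-a)=a$, and $J_a(\phi)=J_{k(1-a)}(\neg\phi^k)$ otherwise; for $a<\frac12$, $J_a(\phi)=J_{1-a}(\neg\phi)$. Further $I_a(\phi)=\bigvee_{b\ge a}J_b(\phi)$.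 **System.** The extended system $S$ is $\mathbf{LCR}$ plus all instances of $\phi\succ\phi$. Its theorems form the least set of formulae that contains - the Rosser–Turquette axioms of Łukasiewicz $m$-valued logic (for all formulae $\phi,\psi,\theta$ and $a,b\in\mathcal T$): $\phi\to(\psi\to\phi)$; $(\phi\to(\psi\to\theta))\to(\psi\to(\phi\to\theta))$; $(\phi\to\psi)\to((\psi\to\theta)\to(\phi\to\theta))$; $(J_a(\phi)\to(J_a(\phi)\to\psi))\to(J_a(\phi)\to\psi)$; $\to_{i=1}^{m}(J_{\frac{i-1}{m-1}}(\phi)\to\psi,\ \psi)$; $J_1(\phi)\to\phi$; $J_a(\phi)\to J_{\sim a}(\neg\phi)$; $J_a(\phi)\to(J_b(\psi)\to J_{a\to b}(\phi\to\psi))$; - all instances of $(\phi\succ(\psi\wedge\theta))\to((\phi\succ\psi)\wedge(\phi\succ\theta))$, of its converse, of $\phi\succ\mathbf t$ and of $\phi\succ\phi$; and is closed under modus ponens, under the rules from $\phi\leftrightarrow\psi$ infer $(\phi\succ\theta)\leftrightarrow(\psi\succ\theta)$ and $(\theta\succ\phi)\leftrightarrow(\theta\succ\psi)$, and, for every $a\in\mathcal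 T$ and with $a_i=\frac{m-i}{m-1}$, under the rule: from $\to_{i=1}^{m}(I_{a_i\odot b}(\gamma_i),I_{a\odot b}(\gamma))$ for every $b\in\mathcal T$ infer $\to_{i=1}^{m}(I_{a_i}(\phi\succ\gamma_i),I_a(\phi\succ\gamma))$. For a set $\Gamma$ of formulae, $\Gamma\vdash_S\phi$ means that $\phi$ is obtained from theorems of $S$ and elements of $\Gamma$ by modus ponens alone. **Models.** A Kripke model consists of a nonempty set $W$, a set $\mathcal A\subseteq\mathcal P(W)^m$, functions $R_X:W\times W\to\mathcal T$ for $X\in\mathcal A$, and values $v_x(p)\in\mathcal T$ for variables $p$ and $x\in W$, such that, with $v$ extended by $v_x(\neg\phi)=\,\sim v_x(\phi)$, $v_x(\phi\to\psi)=v_x(\phi)\to v_x(\psi)$, $v_x(\phi\succ\psi)=\bigwedge_{y\in W}\big(xR_{|\phi|}y\to v_y(\psi)\big)$, where $|\phi|=(|\phi|_1,\dots,|\phi|_m)$ and $|\phi|_i=\{x:v_x(\phi)=\frac{i-1}{m-1}\}$, one has $|\phi|\in\mathcal A$ for every formula $\phi$. The model satisfies (fid) if for all $X\in\mathcal A$,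 $x,y\in W$ and $1\le i\le m$: if $xR_Xy=\frac{i-1}{m-1}$ then $y\in X_j$ for some $j\ge i$. Write $\Gamma\models_{\mathrm{fid}}\phi$ if, at every world $w$ of every model with (fid), $v_w(\psi)=1$ for all $\psi\in\Gamma$ implies $v_w(\phi)=1$. **Theorem.** For every set $\Gamma$ of formulae and every formula $\phi$: 1. (Soundness) if $\Gamma\vdash_S\phi$ then $\Gamma\models_{\mathrm{fid}}\phi$; 2. (Completeness) if $\Gamma\models_{\mathrm{fid}}\phi$ then $\Gamma\vdash_S\phi$. 3. (Canonicity) Call $\Gamma$ consistent if there is no $\phi$ with $\Gamma\vdash_S\phi$ and $\Gamma\vdash_S\neg\phi$. Let $W^c$ be the set of all maximal consistent sets (consistent sets without a proper consistent superset), $/\phi/=(/\phi/_1,\dots,/\phi/_m)$ with $/\phi/_i=\{x\in W^c: J_{\frac{i-1}{m-1}}(\phi)\in x\}$, $\mathcal A^c=\{/\phi/:\phi\text{ a formula}\}$, $xR^c_{/\phi/}y=\bigwedge\{a\to b: J_a(\phi\succ\psi)\in x,\ J_b(\psi)\in y\}$ (over all formulae $\psi$ and all $a,b\in\mathcal T$),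 and $V_x(p)=a$ iff $J_a(p)\in x$. Then $R^c$ and $V$ are well defined, and $\langle W^c,\mathcal A^c,R^c,V\rangle$ is a Kripke model that satisfies (fid). -/

import Mathlib

universe u

/-- Formulae of the conditional language: denumerably many propositional variables, negation,
Łukasiewicz implication and the conditional connective `≻` (`cond`). -/
inductive Formula : Type
  | var : ℕ → Formula
  | neg : Formula → Formula
  | imp : Formula → Formula → Formula
  | cond : Formula → Formula → Formula

namespace Formula

/-- `t := p → p`, for a fixed variable `p`. -/
def tru : Formula := imp (var 0) (var 0)

def or (φ ψ : Formula) : Formula := imp (imp φ ψ) ψ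

def and (φ ψ : Formula) : Formula := neg (or (neg φ) (neg ψ))

/-- Strong conjunction `φ ⊙ ψ`. -/
def odot (φ ψ : Formula) : Formula := neg (imp φ (neg ψ))

def iff (φ ψ : Formula) : Formula := and (imp φ ψ) (imp ψ φ)

/-- `φ_k → (φ_{k-1} → (⋯ → (φ_1 → ψ)))`; the empty chain is `ψ`. -/
def impChain : (k : ℕ) → (Fin k → Formula) → Formula → Formula
  | 0, _, ψ => ψ
  | k + 1, f, ψ => imp (f (Fin.last k)) (impChain k (fun i => f i.castSucc) ψ)

/-- The `⊙`-power `φ ⊙ ⋯ ⊙ φ` with `k` factors (only used for `k ≥ 1`). -/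
def odotPow (φ : Formula) : ℕ → Formula
  | 0 => tru
  | 1 => φ
  | k + 2 => odot (odotPow φ (k + 1)) φ

end Formula

/-! ### Truth values

The truth value `i / (m - 1)` is represented by its numerator `i : Fin m`.
The greatest element `⊤` is the designated value `1`, the least element is `0`. -/

namespace TV

/-- The rational number represented by an element of `Fin m`. -/
def toRat {m : ℕ} (a : Fin m) : ℚ := (a.val : ℚ) / ((m : ℚ) - 1)

/-- `∼ a = 1 - a`. -/
def neg {m : ℕ} (a : Fin m) : Fin m := ⟨m - 1 - a.val, by omega⟩

/-- `a → b = min {1, 1 - a + b}`. -/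
def imp {m : ℕ} (a b : Fin m) : Fin m := ⟨min (m - 1) (m - 1 - a.val + b.val), by omega⟩

/-- `a ⊙ b = max {0, a + b - 1}`. -/
def odot {m : ℕ} (a b : Fin m) : Fin m := ⟨a.val + b.val - (m - 1), by omega⟩

theorem toRat_top {m : ℕ} [m.AtLeastTwo] : toRat (⊤ : Fin m) = 1 := by
  have h2 : 2 ≤ m := Nat.AtLeastTwo.prop
  have hv : (⊤ : Fin m).val = m - 1 := by
    have h : (⟨m - 1, by omega⟩ : Fin m) ≤ ⊤ := le_top
    have h' : m - 1 ≤ (⊤ : Fin m).val := h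
    have := (⊤ : Fin m).isLt
    omega
  have h3 : (2 : ℚ) ≤ m := by exact_mod_cast h2
  unfold toRat
  rw [hv, Nat.cast_sub (by omega), Nat.cast_one]
  exact div_self (by linarith)

theorem toRat_neg {m : ℕ} [m.AtLeastTwo] (a : Fin m) : toRat (neg a) = 1 - toRat a := by
  have h2 : 2 ≤ m := Nat.AtLeastTwo.prop
  have h3 : (2 : ℚ) ≤ m := by exact_mod_cast h2
  have h4 : (m : ℚ) - 1 ≠ 0 := by linarith
  have ha := a.isLt
  simp only [toRat, neg]
  rw [Nat.cast_sub (by omega), Nat.cast_sub (by omega), Nat.cast_one]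
  field_simp

theorem toRat_imp {m : ℕ} [m.AtLeastTwo] (a b : Fin m) :
    toRat (imp a b) = min 1 (1 - toRat a + toRat b) := by
  have h2 : 2 ≤ m := Nat.AtLeastTwo.prop
  have h3 : (2 : ℚ) ≤ m := by exact_mod_cast h2
  have h4 : (m : ℚ) - 1 ≠ 0 := by linarith
  have ha := a.isLt
  simp only [toRat, imp]
  rw [Nat.cast_min, Nat.cast_add, Nat.cast_sub (by omega), Nat.cast_sub (by omega),
    Nat.cast_sub (by omega), Nat.cast_one, ← min_div_div_right (by linarith), div_self h4]
  congr 1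
  field_simp

theorem toRat_odot {m : ℕ} [m.AtLeastTwo] (a b : Fin m) :
    toRat (odot a b) = max 0 (toRat a + toRat b - 1) := by
  have h2 : 2 ≤ m := Nat.AtLeastTwo.prop
  have h3 : (2 : ℚ) ≤ m := by exact_mod_cast h2
  have h4 : (m : ℚ) - 1 ≠ 0 := by linarith
  have h5 : (a.val : ℚ) / ((m : ℚ) - 1) + (b.val : ℚ) / ((m : ℚ) - 1) - 1
      = ((a.val : ℚ) + b.val - (m - 1)) / ((m : ℚ) - 1) := by
    field_simp
  simp only [toRat, odot]
  rw [h5]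
  rcases le_total (m - 1) (a.val + b.val) with h | h
  · rw [Nat.cast_sub h, Nat.cast_add, Nat.cast_sub (by omega), Nat.cast_one]
    have h6 : ((m - 1 : ℕ) : ℚ) ≤ ((a.val + b.val : ℕ) : ℚ) := by exact_mod_cast h
    rw [Nat.cast_sub (by omega), Nat.cast_add, Nat.cast_one] at h6
    exact (max_eq_right (div_nonneg (by linarith) (by linarith))).symm
  · have h6 : ((a.val + b.val : ℕ) : ℚ) ≤ ((m - 1 : ℕ) : ℚ) := by exact_mod_cast h
    rw [Nat.cast_sub (by omega), Nat.cast_add, Nat.cast_one] at h6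
    rw [Nat.sub_eq_zero_of_le h, Nat.cast_zero, zero_div]
    exact (max_eq_left (div_nonpos_of_nonpos_of_nonneg (by linarith) (by linarith))).symm

end TV

namespace Formula

/-- For `a = i / N < 1`, the largest integer `k` with `k * (1 - a) < 1`. -/
def nJ (N i : ℕ) : ℕ := Nat.findGreatest (fun k => k * (N - i) < N) N

theorem lt_nJ_mul {N i : ℕ} (h : i < N) : N ≤ (nJ N i + 1) * (N - i) := by
  by_contra hc
  push Not at hc
  have h1 : 1 ≤ N - i := by omega
  have h2 : nJ N i + 1 ≤ N := by nlinarith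
  have h3 := Nat.le_findGreatest (P := fun k => k * (N - i) < N) h2 hc
  change nJ N i + 1 ≤ nJ N i at h3
  omega

theorem nJ_mul_lt {N i : ℕ} (h : i < N) : nJ N i * (N - i) < N :=
  Nat.findGreatest_spec (P := fun k => k * (N - i) < N) (n := N) (m := 0) (Nat.zero_le _)
    (by simp only [Nat.zero_mul]; omega)

/-- The Rosser–Turquette operator `J_a` for `a = i / N`, where `N = m - 1`:
* `J_1(φ)` is the `⊙`-power of `φ` with `m - 1` factors;
* for `1/2 ≤ a < 1` and `k` the largest integer with `k * (1 - a) < 1`: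
  `J_1(¬ φ^k ↔ φ)` if `k * (1 - a) = a`, and `J_{k (1 - a)}(¬ φ^k)` otherwise;
* `J_{1 - a}(¬ φ)` for `a < 1/2`. -/
def J (N i : ℕ) (φ : Formula) : Formula :=
  if N ≤ i then odotPow φ N
  else if 2 * i < N then J N (N - i) (neg φ)
  else if nJ N i * (N - i) = i then odotPow (iff (neg (odotPow φ (nJ N i))) φ) N
  else J N (nJ N i * (N - i)) (neg (odotPow φ (nJ N i)))
termination_by if 2 * i < N then N + 1 else N - i
decreasing_by
  · rename_i h1 h2
    simp only [h2, if_true]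
    split_ifs <;> omega
  · rename_i h1 h2 h3
    have h4 := lt_nJ_mul (N := N) (i := i) (by omega)
    have h5 := nJ_mul_lt (N := N) (i := i) (by omega)
    rw [Nat.add_mul, Nat.one_mul] at h4
    generalize nJ N i * (N - i) = r at *
    split_ifs <;> omega

/-- `J_{(N-k)/N}(φ) ∨ (⋯ ∨ J_1(φ))`. -/
def disjJ (N : ℕ) (φ : Formula) : ℕ → Formula
  | 0 => J N N φ
  | k + 1 => or (J N (N - (k + 1)) φ) (disjJ N φ k)

/-- `J_a(φ)` for a truth value `a`. -/
def Jop {m : ℕ} (a : Fin m) (φ : Formula) : Formula := J (m - 1) a.val φ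

/-- `I_a(φ)`: the disjunction of all `J_b(φ)` with `a ≤ b ≤ 1`. -/
def Iop {m : ℕ} (a : Fin m) (φ : Formula) : Formula := disjJ (m - 1) φ (m - 1 - a.val)

end Formula

open Formula in
/-- Axioms of Łukasiewicz `m`-valued propositional logic (the Rosser–Turquette schemata),
instantiated by all formulae of the conditional language. The only rule is modus ponens. -/
inductive AxL (m : ℕ) [m.AtLeastTwo] : Formula → Prop
  | weak (φ ψ : Formula) : AxL m (imp φ (imp ψ φ))
  | exch (φ ψ θ : Formula) : AxL m (imp (imp φ (imp ψ θ)) (imp ψ (imp φ θ)))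
  | syll (φ ψ θ : Formula) : AxL m (imp (imp φ ψ) (imp (imp ψ θ) (imp φ θ)))
  | contr (a : Fin m) (φ ψ : Formula) :
      AxL m (imp (imp (Jop a φ) (imp (Jop a φ) ψ)) (imp (Jop a φ) ψ))
  | cases (φ ψ : Formula) : AxL m (impChain m (fun a => imp (Jop a φ) ψ) ψ)
  | des (φ : Formula) : AxL m (imp (Jop (⊤ : Fin m) φ) φ)
  | tabNeg (a : Fin m) (φ : Formula) : AxL m (imp (Jop a φ) (Jop (TV.neg a) (neg φ)))
  | tabImp (a b : Fin m) (φ ψ : Formula) :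
      AxL m (imp (Jop a φ) (imp (Jop b ψ) (Jop (TV.imp a b) (imp φ ψ))))

open Formula in
/-- Theorems of the system **LCR** extended by the additional axioms `Ax`.
In the rule `ruleR`, `a_i = (m - i) / (m - 1)` for `1 ≤ i ≤ m`; with the 0-based index `i : Fin m`
this is the truth value with numerator `m - 1 - i`, i.e. `TV.neg i`. -/
inductive Thm (m : ℕ) [m.AtLeastTwo] (Ax : Set Formula) : Formula → Prop
  | axL {φ : Formula} : AxL m φ → Thm m Ax φ
  | extra {φ : Formula} : φ ∈ Ax → Thm m Ax φ
  | cm (φ ψ θ : Formula) :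
      Thm m Ax (imp (cond φ (and ψ θ)) (and (cond φ ψ) (cond φ θ)))
  | cc (φ ψ θ : Formula) :
      Thm m Ax (imp (and (cond φ ψ) (cond φ θ)) (cond φ (and ψ θ)))
  | cn (φ : Formula) : Thm m Ax (cond φ tru)
  | mp {φ ψ : Formula} : Thm m Ax (imp φ ψ) → Thm m Ax φ → Thm m Ax ψ
  | rcea {φ ψ : Formula} (θ : Formula) :
      Thm m Ax (iff φ ψ) → Thm m Ax (iff (cond φ θ) (cond ψ θ))
  | rcec {φ ψ : Formula} (θ : Formula) :
      Thm m Ax (iff φ ψ) → Thm m Ax (iff (cond θ φ) (cond θ ψ))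
  | ruleR (a : Fin m) (φ γ : Formula) (γs : Fin m → Formula) :
      (∀ b : Fin m, Thm m Ax
        (impChain m (fun i => Iop (TV.odot (TV.neg i) b) (γs i)) (Iop (TV.odot a b) γ))) →
      Thm m Ax (impChain m (fun i => Iop (TV.neg i) (cond φ (γs i))) (Iop a (cond φ γ)))

/-- `Γ ⊢ φ`: `φ` is obtained from theorems and elements of `Γ` by modus ponens. -/
inductive Derives (m : ℕ) [m.AtLeastTwo] (Ax Γ : Set Formula) : Formula → Prop
  | thm {φ : Formula} : Thm m Ax φ → Derives m Ax Γ φ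
  | hyp {φ : Formula} : φ ∈ Γ → Derives m Ax Γ φ
  | mp {φ ψ : Formula} :
      Derives m Ax Γ (Formula.imp φ ψ) → Derives m Ax Γ φ → Derives m Ax Γ ψ

/-- The instances of the axiom schema `φ ≻ φ`. -/
def axLID : Set Formula := {χ | ∃ φ : Formula, χ = Formula.cond φ φ}

/-- The data of a Kripke model: worlds, a set `A` of propositions (`m`-tuples of sets of worlds,
the component with index `i : Fin m` belonging to the truth value `i / (m - 1)`), an `m`-valued
accessibility relation for every `X ∈ A`, and a valuation of the variables. -/
structure KripkeData (m : ℕ) where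
  W : Type u
  A : Set (Fin m → Set W)
  R : A → W → W → Fin m
  ν : ℕ → W → Fin m

namespace KripkeData

variable {m : ℕ} [m.AtLeastTwo]

open Classical in
/-- The relation `R_X`, extended by the value `0` to tuples `X` outside `A`.
In a model (see `IsModel`) this extension is never used in evaluating formulae. -/
noncomputable def rel (M : KripkeData m) (X : Fin m → Set M.W) (x y : M.W) : Fin m :=
  if h : X ∈ M.A then M.R ⟨X, h⟩ x y else ⊥

/-- The value `v_x(φ)`. -/
noncomputable def eval (M : KripkeData m) : Formula → M.W → Fin m
  | .var p, x => M.ν p x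
  | .neg φ, x => TV.neg (eval M φ x)
  | .imp φ ψ, x => TV.imp (eval M φ x) (eval M ψ x)
  | .cond φ ψ, x =>
      ⨅ y : M.W, TV.imp (M.rel (fun i => {z | eval M φ z = i}) x y) (eval M ψ y)

/-- The proposition `|φ|`. -/
def prop (M : KripkeData m) (φ : Formula) : Fin m → Set M.W := fun i => {x | M.eval φ x = i}

/-- Kripke **LCR** models: there is a world, and `R_{|φ|}` is given for every formula `φ`. -/
structure IsModel (M : KripkeData m) : Prop where
  nonempty : Nonempty M.W
  prop_mem : ∀ φ : Formula, M.prop φ ∈ M.A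

/-- Condition (fid). -/
def Fid (M : KripkeData m) : Prop :=
  ∀ (X : M.A) (x y : M.W) (i : Fin m), M.R X x y = i → ∃ j : Fin m, i ≤ j ∧ y ∈ X.val j

end KripkeData

/-- `Γ ⊨ φ` over the class of all Kripke **LCR** models that satisfy (fid). -/
def EntailsFid (m : ℕ) [m.AtLeastTwo] (Γ : Set Formula) (φ : Formula) : Prop :=
  ∀ M : KripkeData.{u} m, M.IsModel → M.Fid →
    ∀ w : M.W, (∀ ψ ∈ Γ, M.eval ψ w = ⊤) → M.eval φ w = ⊤

section Canonical

variable (m : ℕ) [m.AtLeastTwo] (Ax : Set Formula)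

def Consistent (Γ : Set Formula) : Prop :=
  ¬ ∃ φ : Formula, Derives m Ax Γ φ ∧ Derives m Ax Γ (Formula.neg φ)

/-- Maximal consistent sets: consistent sets without a proper consistent superset. -/
def MaxConsistent (Γ : Set Formula) : Prop := Maximal (Consistent m Ax) Γ

/-- Worlds of the canonical model. -/
def CanWorld : Type := {Γ : Set Formula // MaxConsistent m Ax Γ}

/-- The tuple `/φ/`: its component for the truth value `i` consists of the maximal consistent sets
that contain `J_i(φ)`. -/
def canProp (φ : Formula) : Fin m → Set (CanWorld m Ax) :=
  fun i => {x | Formula.Jop i φ ∈ x.val}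

/-- `⋀ {a → b : J_a(φ ≻ ψ) ∈ x, J_b(ψ) ∈ y}`. -/
noncomputable def canRel (φ : Formula) (x y : CanWorld m Ax) : Fin m :=
  sInf {c | ∃ (ψ : Formula) (a b : Fin m),
    Formula.Jop a (Formula.cond φ ψ) ∈ x.val ∧ Formula.Jop b ψ ∈ y.val ∧ c = TV.imp a b}

/-- The canonical model. As the relation belonging to `X = /φ/` must not depend on the choice
of `φ`, it is defined through a chosen representative; likewise the value of `p` at `x` is a chosen
`a` with `J_a(p) ∈ x`. That nothing depends on these choices has to be proved. -/
noncomputable def canonicalModel : KripkeData.{0} m where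
  W := CanWorld m Ax
  A := Set.range (canProp m Ax)
  R := fun X x y => canRel m Ax X.property.choose x y
  ν := fun p x => Classical.epsilon fun a : Fin m => Formula.Jop a (Formula.var p) ∈ x.val

end Canonical

/-! Under every valuation that treats formulae `φ ≻ ψ` as atoms, `J_a(φ)` and `I_a(φ)` take only the
values 0 and 1: they are the indicators of "the value of `φ` is `a`", respectively "is at least
`a`".

Soundness rests on residuation: `a ≤ v_x(φ ≻ ψ)` iff `a ⊙ xR_{|φ|}y ≤ v_y(ψ)` for all `y`. The rule
with parameter `b` is then used at each `y` with `b = xR_{|φ|}y`, and (fid) says exactly that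
`xR_{|φ|}y ≤ v_y(φ)`, which makes `φ ≻ φ` valid.

For completeness, contraction is available only for hypotheses `J_a(φ)`, and so is the deduction
theorem used here. This suffices: a set maximal among those not deriving `χ` contains some `J_a(φ)`
for each `φ`, hence determines a valuation, and it is maximal consistent. Derivability thus becomes
preservation of the value 1 at all canonical worlds.

The core is the truth lemma for `φ ≻ ψ` (`CanWorld.value_cond_eq_iInf`). By definition `R^c` is the
largest relation for which `≤` holds. For `≥`, let `a` be the infimum. For each `b`, the formulae
`I_{w(θ) ⊙ b}(θ)`, with `w(θ)` the value of `φ ≻ θ` at `x`, force `b ≤ xR^c y` at any world `y`,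
hence entail `I_{a ⊙ b}(ψ)`. A derivation uses finitely many `θ`; conjunctions compress them to one
formula per truth value, uniformly in `b`, and the rule yields `I_a(φ ≻ ψ)` at `x`. -/

/-- A valuation of the conditional language that commutes with `¬` and `→`; formulae `φ ≻ ψ` are
treated as atoms. -/
structure IsValuation {m : ℕ} (e : Formula → Fin m) : Prop where
  map_neg : ∀ φ, e (Formula.neg φ) = TV.neg (e φ)
  map_imp : ∀ φ ψ, e (Formula.imp φ ψ) = TV.imp (e φ) (e ψ)

/-! ### Residuation and order on the truth values. -/

theorem TV.odot_le_iff {m : ℕ} (a b c : Fin m) : TV.odot a b ≤ c ↔ a ≤ TV.imp b c := by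
  rw [Fin.le_def, Fin.le_def]
  have := a.isLt
  have := b.isLt
  have := c.isLt
  simp only [TV.imp, TV.odot]
  omega

theorem TV.le_imp_comm {m : ℕ} (a b c : Fin m) : a ≤ TV.imp b c ↔ b ≤ TV.imp a c := by
  rw [Fin.le_def, Fin.le_def]
  have := a.isLt
  have := b.isLt
  have := c.isLt
  simp only [TV.imp]
  omega

theorem TV.neg_neg {m : ℕ} (a : Fin m) : TV.neg (TV.neg a) = a := by
  have := a.isLt
  ext
  simp only [TV.neg]
  omega

section TruthValues

variable {m : ℕ} [m.AtLeastTwo]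

theorem Fin.val_top_of_atLeastTwo : (⊤ : Fin m).val = m - 1 := by
  have h2 : 2 ≤ m := Nat.AtLeastTwo.prop
  have h' : m - 1 ≤ (⊤ : Fin m).val := (le_top : (⟨m - 1, by omega⟩ : Fin m) ≤ ⊤)
  have := (⊤ : Fin m).isLt
  omega

theorem Fin.val_bot_of_atLeastTwo : (⊥ : Fin m).val = 0 := by
  have h2 : 2 ≤ m := Nat.AtLeastTwo.prop
  have h' : (⊥ : Fin m).val ≤ 0 := (bot_le : ⊥ ≤ (⟨0, by omega⟩ : Fin m))
  omega

theorem Fin.eq_top_iff_val (a : Fin m) : a = ⊤ ↔ a.val = m - 1 := by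
  rw [Fin.ext_iff, Fin.val_top_of_atLeastTwo]

theorem TV.imp_eq_top_iff (a b : Fin m) : TV.imp a b = ⊤ ↔ a ≤ b := by
  rw [Fin.eq_top_iff_val, Fin.le_def]
  have := a.isLt
  have := b.isLt
  simp only [TV.imp]
  omega

theorem TV.imp_top_left (a : Fin m) : TV.imp ⊤ a = a := by
  have := a.isLt
  ext
  simp only [TV.imp, Fin.val_top_of_atLeastTwo]
  omega

end TruthValues

/-! ### Values of the defined connectives, and validity of the propositional axioms. -/

namespace IsValuation

open Formula

variable {m : ℕ} {e : Formula → Fin m}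

theorem val_neg (he : IsValuation e) (φ : Formula) :
    (e (neg φ)).val = m - 1 - (e φ).val := by
  rw [he.map_neg]; rfl

theorem val_imp (he : IsValuation e) (φ ψ : Formula) :
    (e (imp φ ψ)).val = min (m - 1) (m - 1 - (e φ).val + (e ψ).val) := by
  rw [he.map_imp]; rfl

theorem val_or (he : IsValuation e) (φ ψ : Formula) :
    (e (or φ ψ)).val = max (e φ).val (e ψ).val := by
  have := (e φ).isLt
  have := (e ψ).isLt
  simp only [Formula.or, he.val_imp]
  omega

theorem val_and (he : IsValuation e) (φ ψ : Formula) :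
    (e (and φ ψ)).val = min (e φ).val (e ψ).val := by
  have := (e φ).isLt
  have := (e ψ).isLt
  simp only [Formula.and, he.val_neg, he.val_or]
  omega

theorem and_eq_inf (he : IsValuation e) (φ ψ : Formula) : e (and φ ψ) = min (e φ) (e ψ) := by
  have h := he.val_and φ ψ
  rcases le_total (e φ) (e ψ) with h' | h'
  · rw [min_eq_left h']
    rw [Fin.le_def] at h'
    ext; omega
  · rw [min_eq_right h']
    rw [Fin.le_def] at h'
    ext; omega

theorem val_odot (he : IsValuation e) (φ ψ : Formula) :
    (e (odot φ ψ)).val = (e φ).val + (e ψ).val - (m - 1) := by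
  have := (e φ).isLt
  have := (e ψ).isLt
  simp only [Formula.odot, he.val_neg, he.val_imp]
  omega

/-- Each further factor loses `1 - e φ`; truncated subtraction stops the loss at 0. -/
theorem val_odotPow_succ (he : IsValuation e) (φ : Formula) (k : ℕ) :
    (e (odotPow φ (k + 1))).val = (m - 1) - (k + 1) * (m - 1 - (e φ).val) := by
  have := (e φ).isLt
  induction k with
  | zero => simp only [Formula.odotPow]; omega
  | succ k ih =>
    rw [Formula.odotPow, he.val_odot, ih, Nat.add_mul (k + 1) 1]
    omega

theorem val_odotPow (he : IsValuation e) (φ : Formula) {k : ℕ} (hk : 1 ≤ k) :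
    (e (odotPow φ k)).val = (m - 1) - k * (m - 1 - (e φ).val) := by
  obtain ⟨k, rfl⟩ := Nat.exists_eq_add_of_le' hk
  exact he.val_odotPow_succ φ k

theorem le_imp (he : IsValuation e) (φ ψ : Formula) : e ψ ≤ e (imp φ ψ) := by
  have := (e ψ).isLt
  rw [Fin.le_def, he.val_imp]
  omega

theorem le_impChain (he : IsValuation e) (k : ℕ) (f : Fin k → Formula) (ψ : Formula) :
    e ψ ≤ e (impChain k f ψ) := by
  induction k with
  | zero => exact le_rfl
  | succ k ih => exact (ih _).trans (he.le_imp _ _)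

section

variable [m.AtLeastTwo]

theorem val_odotPow_self (he : IsValuation e) (φ : Formula) :
    (e (odotPow φ (m - 1))).val = if (e φ).val = m - 1 then m - 1 else 0 := by
  have h2 : 2 ≤ m := Nat.AtLeastTwo.prop
  have h3 := (e φ).isLt
  rw [he.val_odotPow φ (by omega)]
  split_ifs with h
  · rw [h]; simp
  · have : 1 ≤ m - 1 - (e φ).val := by omega
    have := Nat.mul_le_mul_left (m - 1) this
    omega

theorem imp_eq_top_iff (he : IsValuation e) (φ ψ : Formula) :
    e (imp φ ψ) = ⊤ ↔ e φ ≤ e ψ := by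
  rw [he.map_imp, TV.imp_eq_top_iff]

theorem tru_eq_top (he : IsValuation e) : e tru = ⊤ :=
  (he.imp_eq_top_iff _ _).2 le_rfl

theorem iff_eq_top_iff (he : IsValuation e) (φ ψ : Formula) :
    e (iff φ ψ) = ⊤ ↔ e φ = e ψ := by
  rw [Formula.iff, he.and_eq_inf, min_eq_top, he.imp_eq_top_iff, he.imp_eq_top_iff,
    le_antisymm_iff]

theorem val_J (he : IsValuation e) (i : ℕ) (hi : i ≤ m - 1) (φ : Formula) :
    (e (J (m - 1) i φ)).val = if (e φ).val = i then m - 1 else 0 := by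
  have h2 : 2 ≤ m := Nat.AtLeastTwo.prop
  fun_induction J (m - 1) i φ with
  | case1 i φ h =>
    rw [he.val_odotPow_self, show i = m - 1 by omega]
  | case2 i φ h1 h2 ih =>
    have := (e φ).isLt
    rw [ih (by omega), he.val_neg]
    split_ifs <;> omega
  | case3 i φ h1 h2 h3 =>
    have hv := (e φ).isLt
    have hk : 1 ≤ nJ (m - 1) i := by
      by_contra hc
      rw [show nJ (m - 1) i = 0 by omega, Nat.zero_mul] at h3
      omega
    -- As a function of the value `v` of `φ`, `¬φ^k` has value `min {1, k(1 - v)}`, which is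
    -- antitone, so it meets the identity at most once; `k(1 - a) = a` puts the crossing at `a`.
    have key : (e (iff (neg (odotPow φ (nJ (m - 1) i))) φ)).val = m - 1 ↔ (e φ).val = i := by
      rw [← Fin.eq_top_iff_val, he.iff_eq_top_iff, Fin.ext_iff, he.val_neg, he.val_odotPow _ hk]
      constructor
      · intro h
        rcases lt_trichotomy (e φ).val i with h' | h' | h'
        · have : nJ (m - 1) i * (m - 1 - i) ≤ nJ (m - 1) i * (m - 1 - (e φ).val) :=
            Nat.mul_le_mul_left _ (by omega)
          omega
        · exact h'
        · have : nJ (m - 1) i * (m - 1 - (e φ).val) ≤ nJ (m - 1) i * (m - 1 - i) :=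
            Nat.mul_le_mul_left _ (by omega)
          omega
      · intro h
        rw [h, h3]
        omega
    simp only [he.val_odotPow_self, key]
  | case4 i φ h1 h2 h3 ih =>
    have hv := (e φ).isLt
    have hlt := nJ_mul_lt (N := m - 1) (i := i) (by omega)
    have hle := lt_nJ_mul (N := m - 1) (i := i) (by omega)
    have hk : 1 ≤ nJ (m - 1) i := by
      by_contra hc
      rw [show nJ (m - 1) i = 0 by omega] at hle
      omega
    rw [ih hlt.le, he.val_neg, he.val_odotPow _ hk]
    -- Since `k(1 - a) < 1`, the truncation in `min {1, k(1 - v)}` is inactive at the value `k(1 -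
    -- a)`; as `k ≥ 1`, that value is attained only for `v = a`.
    have key : (m - 1 - (m - 1 - nJ (m - 1) i * (m - 1 - (e φ).val)) =
        nJ (m - 1) i * (m - 1 - i)) ↔ (e φ).val = i := by
      constructor
      · intro h
        have h4 : nJ (m - 1) i * (m - 1 - (e φ).val) = nJ (m - 1) i * (m - 1 - i) := by omega
        have := Nat.eq_of_mul_eq_mul_left (by omega) h4
        omega
      · intro h
        rw [h]
        omega
    simp only [key]

theorem val_Jop (he : IsValuation e) (a : Fin m) (φ : Formula) :
    (e (Jop a φ)).val = if e φ = a then m - 1 else 0 := by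
  have := a.isLt
  simp only [Jop, he.val_J a.val (by omega), Fin.ext_iff]

theorem Jop_eq_top_iff (he : IsValuation e) (a : Fin m) (φ : Formula) :
    e (Jop a φ) = ⊤ ↔ e φ = a := by
  have h2 : 2 ≤ m := Nat.AtLeastTwo.prop
  rw [Fin.eq_top_iff_val, he.val_Jop]
  split_ifs with h
  · simp [h]
  · simp only [h, iff_false]; omega

theorem Jop_eq (he : IsValuation e) (a : Fin m) (φ : Formula) :
    e (Jop a φ) = if e φ = a then ⊤ else ⊥ := by
  ext
  rw [he.val_Jop]
  split_ifs
  · rw [Fin.val_top_of_atLeastTwo]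
  · rw [Fin.val_bot_of_atLeastTwo]

theorem val_disjJ (he : IsValuation e) (φ : Formula) (k : ℕ) (hk : k ≤ m - 1) :
    (e (disjJ (m - 1) φ k)).val = if m - 1 - k ≤ (e φ).val then m - 1 else 0 := by
  have := (e φ).isLt
  induction k with
  | zero =>
    rw [disjJ, he.val_J _ le_rfl]
    split_ifs <;> omega
  | succ k ih =>
    rw [disjJ, he.val_or, ih (by omega), he.val_J _ (by omega)]
    split_ifs <;> omega

theorem Iop_eq (he : IsValuation e) (a : Fin m) (φ : Formula) :
    e (Iop a φ) = if a ≤ e φ then ⊤ else ⊥ := by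
  have ha := a.isLt
  have h : (e (Iop a φ)).val = if a ≤ e φ then m - 1 else 0 := by
    simp only [Iop, he.val_disjJ _ _ (show m - 1 - a.val ≤ m - 1 by omega), Fin.le_def,
      show m - 1 - (m - 1 - a.val) = a.val by omega]
  ext
  rw [h]
  split_ifs
  · rw [Fin.val_top_of_atLeastTwo]
  · rw [Fin.val_bot_of_atLeastTwo]

theorem Iop_eq_top_iff (he : IsValuation e) (a : Fin m) (φ : Formula) :
    e (Iop a φ) = ⊤ ↔ a ≤ e φ := by
  have h2 : 2 ≤ m := Nat.AtLeastTwo.prop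
  rw [he.Iop_eq]
  split_ifs with h
  · simp [h]
  · simp only [h, iff_false, Fin.ext_iff, Fin.val_top_of_atLeastTwo, Fin.val_bot_of_atLeastTwo]
    omega

theorem impChain_eq_top_of_le (he : IsValuation e) (k : ℕ) (f : Fin k → Formula) (ψ : Formula)
    (i : Fin k) (h : e (f i) ≤ e ψ) : e (impChain k f ψ) = ⊤ := by
  induction k with
  | zero => exact i.elim0
  | succ k ih =>
    rw [impChain, he.imp_eq_top_iff]
    induction i using Fin.lastCases with
    | last => exact h.trans (he.le_impChain _ _ _)
    | cast i => rw [ih (fun j => f j.castSucc) i h]; exact le_top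

theorem impChain_eq_of_forall_top (he : IsValuation e) (k : ℕ) (f : Fin k → Formula)
    (ψ : Formula) (h : ∀ i, e (f i) = ⊤) : e (impChain k f ψ) = e ψ := by
  induction k with
  | zero => rfl
  | succ k ih =>
    rw [impChain, he.map_imp, h, TV.imp_top_left]
    exact ih _ fun i => h _

/-- The premises have value 0 or 1, so the chain behaves classically: one premise of value 0 makes
it true, and otherwise all premises drop out. -/
theorem impChain_Iop_eq_top_iff (he : IsValuation e) (k : ℕ) (c : Fin k → Fin m)
    (g : Fin k → Formula) (ψ : Formula) :
    e (impChain k (fun i => Iop (c i) (g i)) ψ) = ⊤ ↔ ((∀ i, c i ≤ e (g i)) → e ψ = ⊤) := by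
  by_cases h : ∀ i, c i ≤ e (g i)
  · rw [he.impChain_eq_of_forall_top _ _ _ fun i => (he.Iop_eq_top_iff _ _).2 (h i)]
    simp [h]
  · simp only [h, false_imp_iff, iff_true]
    push Not at h
    obtain ⟨i, hi⟩ := h
    refine he.impChain_eq_top_of_le _ _ _ i ?_
    simp only [he.Iop_eq, not_le.2 hi, if_false]
    exact bot_le

/-- The axioms of Łukasiewicz `m`-valued logic are tautologies. -/
theorem eq_top_of_axL (he : IsValuation e) {φ : Formula} (h : AxL m φ) : e φ = ⊤ := by
  cases h with
  | weak φ ψ => rw [he.imp_eq_top_iff]; exact he.le_imp _ _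
  | exch φ ψ θ =>
    have := (e φ).isLt
    have := (e ψ).isLt
    have := (e θ).isLt
    simp only [Fin.eq_top_iff_val, he.val_imp]
    omega
  | syll φ ψ θ =>
    have := (e φ).isLt
    have := (e ψ).isLt
    have := (e θ).isLt
    simp only [Fin.eq_top_iff_val, he.val_imp]
    omega
  | contr a φ ψ =>
    have := (e ψ).isLt
    simp only [Fin.eq_top_iff_val, he.val_imp, he.val_Jop]
    split_ifs <;> omega
  | cases φ ψ =>
    -- The premise indexed by the actual value of `φ` has antecedent 1, hence the same value as `ψ`.
    refine he.impChain_eq_top_of_le _ _ _ (e φ) ?_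
    have := (e ψ).isLt
    simp only [Fin.le_def, he.val_imp, he.val_Jop, if_true]
    omega
  | des φ =>
    rw [he.imp_eq_top_iff, he.Jop_eq]
    split_ifs with h
    · exact h.ge
    · exact bot_le
  | tabNeg a φ =>
    rw [he.imp_eq_top_iff, he.Jop_eq]
    split_ifs with h
    · exact ((he.Jop_eq_top_iff _ _).2 (by rw [he.map_neg, h])).ge
    · exact bot_le
  | tabImp a b φ ψ =>
    by_cases h : e φ = a
    · by_cases h' : e ψ = b
      · have : e (Jop (TV.imp a b) (imp φ ψ)) = ⊤ :=
          (he.Jop_eq_top_iff _ _).2 (by rw [he.map_imp, h, h'])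
        rw [he.imp_eq_top_iff, (he.imp_eq_top_iff _ _).2 (this ▸ le_top)]
        exact le_top
      · have : e (imp (Jop b ψ) (Jop (TV.imp a b) (imp φ ψ))) = ⊤ := by
          rw [he.imp_eq_top_iff, he.Jop_eq, if_neg h']
          exact bot_le
        rw [he.imp_eq_top_iff, this]
        exact le_top
    · rw [he.imp_eq_top_iff, he.Jop_eq, if_neg h]
      exact bot_le

end

end IsValuation

/-! ### Soundness. -/

namespace KripkeData

open Formula

variable {m : ℕ} [m.AtLeastTwo]

theorem isValuation_eval (M : KripkeData.{u} m) (w : M.W) :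
    IsValuation (fun φ => M.eval φ w) :=
  ⟨fun _ => rfl, fun _ _ => rfl⟩

theorem eval_cond (M : KripkeData.{u} m) (φ ψ : Formula) (w : M.W) :
    M.eval (cond φ ψ) w = ⨅ y : M.W, TV.imp (M.rel (M.prop φ) w y) (M.eval ψ y) := rfl

theorem le_eval_cond_iff (M : KripkeData.{u} m) (a : Fin m) (φ ψ : Formula) (w : M.W) :
    a ≤ M.eval (cond φ ψ) w ↔ ∀ y, TV.odot a (M.rel (M.prop φ) w y) ≤ M.eval ψ y := by
  simp only [eval_cond, le_iInf_iff, TV.odot_le_iff]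

/-- The only component of `|φ|` that contains `y` is the one indexed by the value of `φ` at `y`. -/
theorem rel_le_eval_of_fid {M : KripkeData.{u} m} (hM : M.IsModel) (hF : M.Fid) (φ : Formula)
    (x y : M.W) : M.rel (M.prop φ) x y ≤ M.eval φ y := by
  rw [rel, dif_pos (hM.prop_mem φ)]
  obtain ⟨j, hj, hy⟩ := hF ⟨_, hM.prop_mem φ⟩ x y _ rfl
  have hy' : M.eval φ y = j := hy
  exact hy' ▸ hj

theorem eval_eq_top_of_thm {M : KripkeData.{u} m} (hM : M.IsModel) (hF : M.Fid) {φ : Formula}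
    (h : Thm m axLID φ) (w : M.W) : M.eval φ w = ⊤ := by
  have hv := M.isValuation_eval
  induction h generalizing w with
  | axL h => exact (hv w).eq_top_of_axL h
  | extra h =>
    obtain ⟨φ, rfl⟩ := h
    rw [← top_le_iff, le_eval_cond_iff]
    intro y
    rw [TV.odot_le_iff, TV.le_imp_comm, TV.imp_top_left]
    exact rel_le_eval_of_fid hM hF φ w y
  | cm φ ψ θ =>
    refine ((hv w).imp_eq_top_iff _ _).2 ?_
    refine le_of_le_of_eq ?_ ((hv w).and_eq_inf _ _).symm
    refine le_min ?_ ?_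
    · refine (le_eval_cond_iff _ _ _ _ _).2 fun y => ((le_eval_cond_iff _ _ _ _ _).1 le_rfl y).trans ?_
      exact ((hv y).and_eq_inf _ _).trans_le (min_le_left _ _)
    · refine (le_eval_cond_iff _ _ _ _ _).2 fun y => ((le_eval_cond_iff _ _ _ _ _).1 le_rfl y).trans ?_
      exact ((hv y).and_eq_inf _ _).trans_le (min_le_right _ _)
  | cc φ ψ θ =>
    refine ((hv w).imp_eq_top_iff _ _).2 ?_
    refine (le_eval_cond_iff _ _ _ _ _).2 fun y => ?_
    refine le_of_le_of_eq ?_ ((hv y).and_eq_inf _ _).symm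
    refine le_min ?_ ?_
    · exact (le_eval_cond_iff _ _ _ _ _).1 (((hv w).and_eq_inf _ _).trans_le (min_le_left _ _)) y
    · exact (le_eval_cond_iff _ _ _ _ _).1 (((hv w).and_eq_inf _ _).trans_le (min_le_right _ _)) y
  | cn φ =>
    rw [← top_le_iff, le_eval_cond_iff]
    intro y
    exact le_top.trans (hv y).tru_eq_top.ge
  | mp _ _ ih1 ih2 =>
    exact top_le_iff.1 ((ih2 w).ge.trans (((hv w).imp_eq_top_iff _ _).1 (ih1 w)))
  | @rcea φ ψ θ _ ih =>
    have h : M.prop φ = M.prop ψ := by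
      ext i x
      have := ((hv x).iff_eq_top_iff _ _).1 (ih x)
      simp only [prop, Set.mem_ofPred_eq]
      rw [this]
    refine ((hv w).iff_eq_top_iff _ _).2 ?_
    simp only [eval_cond, h]
  | @rcec φ ψ θ _ ih =>
    have h : ∀ y, M.eval φ y = M.eval ψ y := fun y => ((hv y).iff_eq_top_iff _ _).1 (ih y)
    refine ((hv w).iff_eq_top_iff _ _).2 ?_
    simp only [eval_cond, h]
  | ruleR a φ γ γs _ ih =>
    refine ((hv w).impChain_Iop_eq_top_iff _ _ _ _).2 fun h => ?_
    refine ((hv w).Iop_eq_top_iff _ _).2 ?_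
    refine (le_eval_cond_iff _ _ _ _ _).2 fun y => ?_
    refine ((hv y).Iop_eq_top_iff _ _).1 ?_
    -- The premise of the rule is needed only for `b` equal to the degree of accessibility from `w`
    -- to `y`.
    refine ((hv y).impChain_Iop_eq_top_iff _ _ _ _).1 (ih (M.rel (M.prop φ) w y) y) fun i => ?_
    exact (le_eval_cond_iff _ _ _ _ _).1 (h i) y

end KripkeData

/-- Strong soundness. -/
theorem Derives.entailsFid {m : ℕ} [m.AtLeastTwo] {Γ : Set Formula} {φ : Formula}
    (h : Derives m axLID Γ φ) : EntailsFid.{u} m Γ φ := by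
  intro M hM hF w hw
  have hv := M.isValuation_eval w
  induction h with
  | thm h => exact KripkeData.eval_eq_top_of_thm hM hF h w
  | hyp h => exact hw _ h
  | mp _ _ ih1 ih2 => exact top_le_iff.1 (ih2.ge.trans ((hv.imp_eq_top_iff _ _).1 ih1))

/-! ### Derivations from hypotheses and Lindenbaum's lemma. -/

namespace Derives

open Formula

variable {m : ℕ} [m.AtLeastTwo] {Ax Γ Δ : Set Formula} {φ ψ θ χ : Formula}

theorem mono (h : Γ ⊆ Δ) (hφ : Derives m Ax Γ φ) : Derives m Ax Δ φ := by
  induction hφ with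
  | thm h => exact thm h
  | hyp h' => exact hyp (h h')
  | mp _ _ ih1 ih2 => exact mp ih1 ih2

theorem cut (h : ∀ ψ ∈ Δ, Derives m Ax Γ ψ) (hφ : Derives m Ax Δ φ) : Derives m Ax Γ φ := by
  induction hφ with
  | thm h => exact thm h
  | hyp h' => exact h _ h'
  | mp _ _ ih1 ih2 => exact mp ih1 ih2

theorem thm_of_empty (h : Derives m Ax ∅ φ) : Thm m Ax φ := by
  induction h with
  | thm h => exact h
  | hyp h => exact h.elim
  | mp _ _ ih1 ih2 => exact .mp ih1 ih2

theorem axL (h : AxL m φ) : Derives m Ax Γ φ := thm (.axL h)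

theorem weaken (h : Derives m Ax Γ φ) (ψ : Formula) : Derives m Ax Γ (imp ψ φ) :=
  mp (axL (.weak φ ψ)) h

theorem imp_refl (φ : Formula) : Derives m Ax Γ (imp φ φ) :=
  mp (mp (axL (.exch φ (imp φ (imp φ φ)) φ)) (axL (.weak φ _))) (axL (.weak φ φ))

/-- The deduction theorem for hypotheses of the form `J_a(φ)`. -/
theorem imp_of_insert_Jop {a : Fin m} (h : Derives m Ax (insert (Jop a φ) Γ) χ) :
    Derives m Ax Γ (imp (Jop a φ) χ) := by
  induction h with
  | thm h => exact (thm h).weaken _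
  | hyp h =>
    rcases h with rfl | h
    · exact imp_refl _
    · exact (hyp h).weaken _
  | mp _ _ ih1 ih2 =>
    -- Exchange and transitivity leave `J_a(φ)` as antecedent twice; the restricted contraction
    -- axiom merges the two.
    exact mp (axL (.contr a φ _)) (mp (mp (axL (.syll _ _ _)) ih2) (mp (axL (.exch _ _ _)) ih1))

theorem of_impChain {k : ℕ} {f : Fin k → Formula} (h : Derives m Ax Γ (impChain k f χ))
    (hf : ∀ i, Derives m Ax Γ (f i)) : Derives m Ax Γ χ := by
  induction k with
  | zero => exact h
  | succ k ih => exact ih (mp h (hf _)) fun i => hf _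

theorem of_forall_insert_Jop (φ : Formula)
    (h : ∀ a : Fin m, Derives m Ax (insert (Jop a φ) Γ) χ) : Derives m Ax Γ χ :=
  of_impChain (axL (.cases φ χ)) fun a => imp_of_insert_Jop (h a)

theorem of_mem_of_chain {c : Set (Set Formula)} (hc : IsChain (· ⊆ ·) c) (hne : c.Nonempty)
    (h : Derives m Ax (⋃₀ c) φ) : ∃ Δ ∈ c, Derives m Ax Δ φ := by
  induction h with
  | thm h => exact ⟨_, hne.choose_spec, thm h⟩
  | hyp h =>
    obtain ⟨Δ, hΔ, h⟩ := h
    exact ⟨Δ, hΔ, hyp h⟩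
  | mp _ _ ih1 ih2 =>
    obtain ⟨Δ₁, h₁, d₁⟩ := ih1
    obtain ⟨Δ₂, h₂, d₂⟩ := ih2
    rcases hc.total h₁ h₂ with h | h
    · exact ⟨Δ₂, h₂, mp (d₁.mono h) d₂⟩
    · exact ⟨Δ₁, h₁, mp d₁ (d₂.mono h)⟩

/-- Lindenbaum's lemma. -/
theorem exists_maximal (h : ¬ Derives m Ax Γ χ) :
    ∃ Δ, Γ ⊆ Δ ∧ Maximal (fun Δ => ¬ Derives m Ax Δ χ) Δ := by
  refine zorn_subset_nonempty {Δ | ¬ Derives m Ax Δ χ} (fun c hcs hc hne => ?_) Γ h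
  refine ⟨⋃₀ c, fun hd => ?_, fun s hs => Set.subset_sUnion_of_mem hs⟩
  obtain ⟨Δ, hΔ, hd⟩ := of_mem_of_chain hc hne hd
  exact hcs hΔ hd

theorem mem_of_maximal (hΔ : Maximal (fun Δ => ¬ Derives m Ax Δ χ) Δ)
    (h : Derives m Ax Δ φ) : φ ∈ Δ := by
  refine hΔ.le_of_ge (y := insert φ Δ) (fun hd => hΔ.prop (hd.cut ?_)) (Set.subset_insert _ _)
    (Set.mem_insert _ _)
  rintro ψ (rfl | hψ)
  · exact h
  · exact hyp hψ

theorem insert_of_maximal (hΔ : Maximal (fun Δ => ¬ Derives m Ax Δ χ) Δ)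
    (h : φ ∉ Δ) : Derives m Ax (insert φ Δ) χ := by
  by_contra hd
  exact h (hΔ.le_of_ge hd (Set.subset_insert _ _) (Set.mem_insert _ _))

/-- If every `J_a(φ)` were missing, each would derive `χ` when added, and the case-distinction axiom
would derive `χ` outright. -/
theorem exists_Jop_mem_of_maximal (hΔ : Maximal (fun Δ => ¬ Derives m Ax Δ χ) Δ)
    (φ : Formula) : ∃ a : Fin m, Jop a φ ∈ Δ := by
  by_contra! h
  exact hΔ.prop (of_forall_insert_Jop φ fun a => insert_of_maximal hΔ (h a))

end Derives

/-- The valuation that extends given values of variables and of formulae `φ ≻ ψ`. -/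
def extendVal {m : ℕ} (f : Formula → Fin m) : Formula → Fin m
  | .var p => f (.var p)
  | .neg φ => TV.neg (extendVal f φ)
  | .imp φ ψ => TV.imp (extendVal f φ) (extendVal f ψ)
  | .cond φ ψ => f (.cond φ ψ)

theorem isValuation_extendVal {m : ℕ} (f : Formula → Fin m) : IsValuation (extendVal f) :=
  ⟨fun _ => rfl, fun _ _ => rfl⟩

/-! ### From maximal sets to valuations. -/

section Completeness

open Formula

variable {m : ℕ} [m.AtLeastTwo] {Ax Γ Δ : Set Formula} {φ ψ θ χ : Formula}

/-- Values are chosen only for atoms, since uniqueness of `a` with `J_a(φ) ∈ Δ` is not yet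
available; the truth-table axioms propagate membership to compound formulae. -/
theorem exists_isValuation_of_maximal (hΔ : Maximal (fun Δ => ¬ Derives m Ax Δ χ) Δ) :
    ∃ e : Formula → Fin m, IsValuation e ∧ ∀ φ, Jop (e φ) φ ∈ Δ := by
  choose f hf using Derives.exists_Jop_mem_of_maximal hΔ
  refine ⟨extendVal f, isValuation_extendVal f, fun φ => ?_⟩
  induction φ with
  | var p => exact hf _
  | neg φ ih =>
    exact Derives.mem_of_maximal hΔ (.mp (.axL (.tabNeg _ _)) (.hyp ih))
  | imp φ ψ ih1 ih2 =>
    exact Derives.mem_of_maximal hΔ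
      (.mp (.mp (.axL (.tabImp _ _ _ _)) (.hyp ih1)) (.hyp ih2))
  | cond φ ψ => exact hf _

/-- Weak completeness of the propositional part: every tautology is a theorem. -/
theorem Thm.of_tautology (h : ∀ e : Formula → Fin m, IsValuation e → e φ = ⊤) : Thm m Ax φ := by
  by_contra hn
  obtain ⟨Δ, -, hΔ⟩ := Derives.exists_maximal (fun hd => hn (Derives.thm_of_empty hd))
  obtain ⟨e, he, hJ⟩ := exists_isValuation_of_maximal hΔ
  exact hΔ.prop (.mp (.axL (.des φ)) (h e he ▸ .hyp (hJ φ)))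

namespace Derives

theorem Jop_top (h : Derives m Ax Γ φ) : Derives m Ax Γ (Jop (⊤ : Fin m) φ) := by
  have key : ∀ n, Derives m Ax Γ (odotPow φ (n + 1)) := by
    intro n
    induction n with
    | zero => exact h
    | succ n ih =>
      refine mp (mp (thm (.of_tautology fun e he => ?_)) ih) h
      rw [odotPow, he.imp_eq_top_iff, Fin.le_def, he.val_imp, he.val_odot]
      have := (e φ).isLt
      have := (e (odotPow φ (n + 1))).isLt
      omega
  have h2 : 2 ≤ m := Nat.AtLeastTwo.prop
  have := key (m - 2)
  rw [show m - 2 + 1 = m - 1 by omega] at this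
  rw [Jop, J, if_pos Fin.val_top_of_atLeastTwo.ge]
  exact this

theorem of_Jop_ne {a b : Fin m} (hab : a ≠ b) (h₁ : Derives m Ax Γ (Jop a φ))
    (h₂ : Derives m Ax Γ (Jop b φ)) (χ : Formula) : Derives m Ax Γ χ := by
  refine mp (mp (thm (.of_tautology fun e he => ?_)) h₁) h₂
  rw [he.imp_eq_top_iff, he.Jop_eq]
  split_ifs with h
  · rw [top_le_iff, he.imp_eq_top_iff, he.Jop_eq, if_neg (h ▸ hab)]
    exact bot_le
  · exact bot_le

theorem of_neg (h₁ : Derives m Ax Γ φ) (h₂ : Derives m Ax Γ (neg φ)) (χ : Formula) :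
    Derives m Ax Γ χ := by
  refine mp (mp (thm (.of_tautology fun e he => ?_)) h₁) h₂
  rw [he.imp_eq_top_iff, Fin.le_def, he.val_imp, he.val_neg]
  have := (e φ).isLt
  omega

end Derives

/-- Turns consistency into non-derivability of one fixed formula, so that the results on maximal
non-deriving sets apply. -/
theorem consistent_iff : Consistent m Ax Γ ↔ ¬ Derives m Ax Γ (neg tru) := by
  refine not_congr ⟨fun ⟨φ, h₁, h₂⟩ => h₁.of_neg h₂ _, fun h => ⟨tru, .thm ?_, h⟩⟩
  exact .of_tautology fun e he => he.tru_eq_top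

theorem MaxConsistent.maximal (h : MaxConsistent m Ax Γ) :
    Maximal (fun Δ => ¬ Derives m Ax Δ (neg tru)) Γ := by
  have : Consistent m Ax = fun Δ => ¬ Derives m Ax Δ (neg tru) :=
    funext fun Δ => propext consistent_iff
  rw [← this]
  exact h

/-- A proper extension derives `χ`, hence `J_1(χ)`, but already contains `J_c(χ)` for some `c ≠ 1`;
so it is inconsistent. -/
theorem maxConsistent_of_maximal (hΔ : Maximal (fun Δ => ¬ Derives m Ax Δ χ) Δ) :
    MaxConsistent m Ax Δ := by
  refine ⟨fun ⟨φ, h₁, h₂⟩ => hΔ.prop (h₁.of_neg h₂ _), fun Δ' hc hle φ hφ => ?_⟩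
  by_contra hn
  obtain ⟨e, he, hJ⟩ := exists_isValuation_of_maximal hΔ
  have h₁ : Derives m Ax Δ' (Jop (e χ) χ) := .hyp (hle (hJ χ))
  have h₂ : Derives m Ax Δ' (Jop (⊤ : Fin m) χ) :=
    ((Derives.insert_of_maximal hΔ hn).mono (Set.insert_subset hφ hle)).Jop_top
  refine consistent_iff.1 hc (h₁.of_Jop_ne (fun h => hΔ.prop ?_) h₂ _)
  exact .mp (.axL (.des χ)) (h ▸ .hyp (hJ χ))

/-! ### Canonical worlds, canonical relation and truth lemma. -/

namespace CanWorld

/-- The truth value of a formula at a maximal consistent set. -/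
noncomputable def value (x : CanWorld m Ax) (φ : Formula) : Fin m :=
  Classical.epsilon fun a : Fin m => Jop a φ ∈ x.val

theorem mem_of_derives (x : CanWorld m Ax) (h : Derives m Ax x.val φ) : φ ∈ x.val :=
  Derives.mem_of_maximal x.property.maximal h

theorem Jop_value_mem (x : CanWorld m Ax) (φ : Formula) : Jop (x.value φ) φ ∈ x.val :=
  Classical.epsilon_spec (Derives.exists_Jop_mem_of_maximal x.property.maximal φ)

theorem value_eq_iff (x : CanWorld m Ax) (φ : Formula) (a : Fin m) :
    x.value φ = a ↔ Jop a φ ∈ x.val := by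
  refine ⟨fun h => h ▸ x.Jop_value_mem φ, fun h => ?_⟩
  by_contra hn
  exact x.property.maximal.prop (.of_Jop_ne hn (.hyp (x.Jop_value_mem φ)) (.hyp h) _)

theorem isValuation_value (x : CanWorld m Ax) : IsValuation x.value := by
  obtain ⟨e, he, hJ⟩ := exists_isValuation_of_maximal x.property.maximal
  have : x.value = e := funext fun φ => (x.value_eq_iff φ _).2 (hJ φ)
  exact this ▸ he

theorem value_eq_top_iff (x : CanWorld m Ax) (φ : Formula) : x.value φ = ⊤ ↔ φ ∈ x.val := by
  rw [value_eq_iff]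
  exact ⟨fun h => x.mem_of_derives (.mp (.axL (.des φ)) (.hyp h)),
    fun h => x.mem_of_derives (Derives.hyp h).Jop_top⟩

theorem value_eq_top_of_thm (x : CanWorld m Ax) (h : Thm m Ax φ) : x.value φ = ⊤ :=
  (x.value_eq_top_iff φ).2 (x.mem_of_derives (.thm h))

theorem exists_of_not_derives (h : ¬ Derives m Ax Γ φ) :
    ∃ x : CanWorld m Ax, Γ ⊆ x.val ∧ φ ∉ x.val := by
  obtain ⟨Δ, hle, hΔ⟩ := Derives.exists_maximal h
  exact ⟨⟨Δ, maxConsistent_of_maximal hΔ⟩, hle, fun h => hΔ.prop (.hyp h)⟩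

/-- Replaces syntactic derivations by computation with truth values at the canonical worlds. -/
theorem derives_of_forall_value
    (h : ∀ x : CanWorld m Ax, (∀ ψ ∈ Γ, x.value ψ = ⊤) → x.value φ = ⊤) : Derives m Ax Γ φ := by
  by_contra hn
  obtain ⟨x, hle, hx⟩ := exists_of_not_derives hn
  exact hx ((x.value_eq_top_iff φ).1 (h x fun ψ hψ => (x.value_eq_top_iff ψ).2 (hle hψ)))

theorem thm_of_forall_value (h : ∀ x : CanWorld m Ax, x.value φ = ⊤) : Thm m Ax φ :=
  (derives_of_forall_value fun x _ => h x).thm_of_empty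

theorem value_cond_and (x : CanWorld m Ax) (φ ψ θ : Formula) :
    x.value (cond φ (and ψ θ)) = min (x.value (cond φ ψ)) (x.value (cond φ θ)) := by
  have hv := x.isValuation_value
  rw [← hv.and_eq_inf]
  exact le_antisymm ((hv.imp_eq_top_iff _ _).1 (x.value_eq_top_of_thm (.cm φ ψ θ)))
    ((hv.imp_eq_top_iff _ _).1 (x.value_eq_top_of_thm (.cc φ ψ θ)))

theorem value_cond_tru (x : CanWorld m Ax) (φ : Formula) : x.value (cond φ tru) = ⊤ :=
  x.value_eq_top_of_thm (.cn φ)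

theorem value_cond_congr (h : ∀ y : CanWorld m Ax, y.value φ = y.value ψ) (θ : Formula)
    (x : CanWorld m Ax) : x.value (cond φ θ) = x.value (cond ψ θ) :=
  (x.isValuation_value.iff_eq_top_iff _ _).1 (x.value_eq_top_of_thm
    (.rcea θ (thm_of_forall_value fun y => (y.isValuation_value.iff_eq_top_iff _ _).2 (h y))))

/-- A consequence of the formulae `I_{w(θ) ⊙ b}(θ)`, where `w(θ)` is the value of `φ ≻ θ` at `x`,
follows from one formula `γ c` for every truth value `c`. -/
theorem exists_family_of_derives (x : CanWorld m Ax) (φ : Formula) (b : Fin m)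
    (h : Derives m Ax {χ | ∃ θ, χ = Iop (TV.odot (x.value (cond φ θ)) b) θ} χ) :
    ∃ γ : Fin m → Formula, (∀ c, c ≤ x.value (cond φ (γ c))) ∧
      ∀ y : CanWorld m Ax, (∀ c, TV.odot c b ≤ y.value (γ c)) → y.value χ = ⊤ := by
  induction h with
  | thm h => exact ⟨fun _ => tru, fun c => (x.value_cond_tru φ).symm ▸ le_top,
      fun y _ => y.value_eq_top_of_thm h⟩
  | hyp h =>
    obtain ⟨θ, rfl⟩ := h
    -- `θ` sits at the index of its own weight; elsewhere `tru` is harmless because `φ ≻ tru` has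
    -- value 1.
    refine ⟨fun c => if c = x.value (cond φ θ) then θ else tru, fun c => ?_, fun y hy => ?_⟩
    · dsimp only
      split_ifs with h
      · exact h.le
      · exact (x.value_cond_tru φ).symm ▸ le_top
    · have := hy (x.value (cond φ θ))
      simp only [if_true] at this
      exact (y.isValuation_value.Iop_eq_top_iff _ _).2 this
  | mp _ _ ih1 ih2 =>
    obtain ⟨γ₁, h₁, k₁⟩ := ih1
    obtain ⟨γ₂, h₂, k₂⟩ := ih2
    refine ⟨fun c => and (γ₁ c) (γ₂ c), fun c => ?_, fun y hy => ?_⟩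
    · rw [value_cond_and]
      exact le_min (h₁ c) (h₂ c)
    · have hv := y.isValuation_value
      simp only [hv.and_eq_inf, le_min_iff] at hy
      exact top_le_iff.1 ((k₂ y fun c => (hy c).2).ge.trans
        ((hv.imp_eq_top_iff _ _).1 (k₁ y fun c => (hy c).1)))

theorem canRel_eq_iInf (φ : Formula) (x y : CanWorld m Ax) :
    canRel m Ax φ x y = ⨅ θ, TV.imp (x.value (cond φ θ)) (y.value θ) := by
  rw [canRel, iInf]
  congr 1
  ext c
  constructor
  · rintro ⟨θ, a, b, ha, hb, rfl⟩
    exact ⟨θ, congrArg₂ TV.imp ((x.value_eq_iff _ _).2 ha) ((y.value_eq_iff _ _).2 hb)⟩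
  · rintro ⟨θ, rfl⟩
    exact ⟨θ, _, _, x.Jop_value_mem _, y.Jop_value_mem _, rfl⟩

/-- Independence of the representative: equal tuples mean equal values at every world, so `φ ↔ ψ` is
a theorem and the antecedent congruence rule applies. -/
theorem canRel_congr (h : canProp m Ax φ = canProp m Ax ψ) (x y : CanWorld m Ax) :
    canRel m Ax φ x y = canRel m Ax ψ x y := by
  have h' : ∀ y : CanWorld m Ax, y.value φ = y.value ψ := fun y => by
    have : y ∈ canProp m Ax ψ (y.value φ) := h ▸ y.Jop_value_mem φ
    exact ((y.value_eq_iff _ _).2 this).symm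
  simp only [canRel_eq_iInf, value_cond_congr h']

/-- The truth lemma for formulae `φ ≻ ψ`. -/
theorem value_cond_eq_iInf (x : CanWorld m Ax) (φ ψ : Formula) :
    x.value (cond φ ψ) = ⨅ y : CanWorld m Ax, TV.imp (canRel m Ax φ x y) (y.value ψ) := by
  refine le_antisymm (le_iInf fun y => ?_) ?_
  · rw [TV.le_imp_comm, canRel_eq_iInf]
    exact iInf_le _ ψ
  · set a := ⨅ y : CanWorld m Ax, TV.imp (canRel m Ax φ x y) (y.value ψ) with ha
    have hb : ∀ b : Fin m, ∃ γ : Fin m → Formula, (∀ c, c ≤ x.value (cond φ (γ c))) ∧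
        ∀ y : CanWorld m Ax, (∀ c, TV.odot c b ≤ y.value (γ c)) →
          y.value (Iop (TV.odot a b) ψ) = ⊤ := by
      refine fun b => exists_family_of_derives x φ b (derives_of_forall_value fun y hy => ?_)
      have hv := y.isValuation_value
      rw [hv.Iop_eq_top_iff, TV.odot_le_iff]
      -- By residuation, the premises holding at `y` say that `b` is a lower bound of the infimum
      -- defining `R^c`.
      have hle : b ≤ canRel m Ax φ x y := by
        rw [canRel_eq_iInf]
        refine le_iInf fun θ => ?_
        rw [TV.le_imp_comm, ← TV.odot_le_iff, ← hv.Iop_eq_top_iff]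
        exact hy _ ⟨θ, rfl⟩
      have hay : a ≤ TV.imp (canRel m Ax φ x y) (y.value ψ) := iInf_le _ y
      rw [TV.le_imp_comm] at hay ⊢
      exact hle.trans hay
    -- The rule requires the same formulae for all `b`, so the families for the individual `b` are
    -- conjoined.
    have hs : ∀ s : Finset (Fin m), ∃ γ : Fin m → Formula, (∀ c, c ≤ x.value (cond φ (γ c))) ∧
        ∀ b ∈ s, ∀ y : CanWorld m Ax, (∀ c, TV.odot c b ≤ y.value (γ c)) →
          y.value (Iop (TV.odot a b) ψ) = ⊤ := by
      intro s
      induction s using Finset.induction_on with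
      | empty => exact ⟨fun _ => tru, fun c => (x.value_cond_tru φ).symm ▸ le_top, by simp⟩
      | insert b s _ ih =>
        obtain ⟨γ₁, h₁, k₁⟩ := hb b
        obtain ⟨γ₂, h₂, k₂⟩ := ih
        refine ⟨fun c => and (γ₁ c) (γ₂ c), fun c => ?_, fun b' hb' y hy => ?_⟩
        · rw [value_cond_and]
          exact le_min (h₁ c) (h₂ c)
        · simp only [y.isValuation_value.and_eq_inf, le_min_iff] at hy
          rcases Finset.mem_insert.1 hb' with rfl | hb'
          · exact k₁ y fun c => (hy c).1
          · exact k₂ b' hb' y fun c => (hy c).2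
    obtain ⟨γ, h, k⟩ := hs Finset.univ
    -- The `i`-th premise of the rule carries the weight `TV.neg i`, hence the reindexing of `γ`.
    have hthm := Thm.ruleR (Ax := Ax) a φ ψ (fun i => γ (TV.neg i)) fun b =>
      thm_of_forall_value fun y =>
        (y.isValuation_value.impChain_Iop_eq_top_iff _ _ _ _).2 fun hy =>
          k b (Finset.mem_univ b) y fun c => by simpa only [TV.neg_neg] using hy (TV.neg c)
    have hv := x.isValuation_value
    rw [← hv.Iop_eq_top_iff]
    exact (hv.impChain_Iop_eq_top_iff _ _ _ _).1 (x.value_eq_top_of_thm hthm) fun i => h _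

end CanWorld

theorem canonicalModel_R (φ : Formula) (x y : CanWorld m Ax) :
    (canonicalModel m Ax).R ⟨canProp m Ax φ, Set.mem_range_self φ⟩ x y = canRel m Ax φ x y :=
  CanWorld.canRel_congr (Set.mem_range_self φ).choose_spec x y

theorem canonicalModel_rel (φ : Formula) (x y : CanWorld m Ax) :
    (canonicalModel m Ax).rel (canProp m Ax φ) x y = canRel m Ax φ x y := by
  have h : canProp m Ax φ ∈ (canonicalModel m Ax).A := Set.mem_range_self φ
  exact (dif_pos h).trans (canonicalModel_R φ x y)

/-- The truth lemma. -/
theorem canonicalModel_eval (φ : Formula) (x : CanWorld m Ax) :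
    (canonicalModel m Ax).eval φ x = x.value φ := by
  induction φ generalizing x with
  | var p => rfl
  | neg φ ih => exact (congrArg TV.neg (ih x)).trans (x.isValuation_value.map_neg φ).symm
  | imp φ ψ ih1 ih2 =>
    exact (congrArg₂ TV.imp (ih1 x) (ih2 x)).trans (x.isValuation_value.map_imp φ ψ).symm
  | cond φ ψ ih1 ih2 =>
    have h : (canonicalModel m Ax).prop φ = canProp m Ax φ := by
      ext i y
      exact (Eq.congr_left (ih1 y)).trans (y.value_eq_iff φ i)
    refine (KripkeData.eval_cond _ _ _ _).trans (Eq.trans ?_ (x.value_cond_eq_iInf φ ψ).symm)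
    rw [h]
    exact iInf_congr fun y => congrArg₂ TV.imp (canonicalModel_rel φ x y) (ih2 y)

theorem canonicalModel_prop (φ : Formula) :
    (canonicalModel m Ax).prop φ = canProp m Ax φ := by
  ext i y
  exact (Eq.congr_left (canonicalModel_eval φ y)).trans (CanWorld.value_eq_iff y φ i)

end Completeness

/-! ### Consistency, canonicity and strong completeness. -/

section Main

open Formula

variable {m : ℕ} [m.AtLeastTwo]

/-- A one-world model in which the accessibility relations are constantly `0`. -/
noncomputable def trivialModel (m : ℕ) [m.AtLeastTwo] : KripkeData.{0} m where
  W := Unit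
  A := {X | ∃ j, () ∈ X j}
  R := fun _ _ _ => ⊥
  ν := fun _ _ => ⊥

theorem isModel_trivialModel : (trivialModel m).IsModel :=
  ⟨⟨()⟩, fun φ => ⟨(trivialModel m).eval φ (), rfl⟩⟩

/-- `A` admits only tuples with a component containing the world, which is all that (fid) asks of a
relation with value 0. -/
theorem fid_trivialModel : (trivialModel m).Fid := by
  rintro ⟨X, j, hj⟩ x y i rfl
  exact ⟨j, bot_le, hj⟩

/-- Consistency of the system, by soundness in the one-world model; it supplies a canonical world.
-/
theorem not_derives_neg_tru : ¬ Derives m axLID ∅ (neg tru) := by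
  intro h
  have h' := h.entailsFid _ isModel_trivialModel fid_trivialModel () (by simp)
  have hv := (trivialModel m).isValuation_eval ()
  have h2 : 2 ≤ m := Nat.AtLeastTwo.prop
  have h1 := hv.val_neg tru
  rw [hv.tru_eq_top, h', Fin.val_top_of_atLeastTwo] at h1
  omega

theorem isModel_canonicalModel : (canonicalModel m axLID).IsModel := by
  obtain ⟨x, -⟩ := CanWorld.exists_of_not_derives (not_derives_neg_tru (m := m))
  exact ⟨⟨x⟩, fun φ => ⟨φ, (canonicalModel_prop φ).symm⟩⟩

theorem fid_canonicalModel : (canonicalModel m axLID).Fid := by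
  rintro ⟨_, φ, rfl⟩ (x : CanWorld m axLID) (y : CanWorld m axLID) i rfl
  refine ⟨y.value φ, ?_, y.Jop_value_mem φ⟩
  refine (canonicalModel_R φ x y).trans_le ?_
  rw [CanWorld.canRel_eq_iInf]
  -- The term `θ = φ` of the infimum is `1 → v_y(φ)`, thanks to the axiom `φ ≻ φ`.
  refine (iInf_le _ φ).trans_eq ?_
  rw [x.value_eq_top_of_thm (.extra ⟨φ, rfl⟩), TV.imp_top_left]

/-- Strong completeness. -/
theorem EntailsFid.derives {Γ : Set Formula} {φ : Formula} (h : EntailsFid.{0} m Γ φ) :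
    Derives m axLID Γ φ := by
  refine CanWorld.derives_of_forall_value fun x hx => ?_
  have := h (canonicalModel m axLID) isModel_canonicalModel fid_canonicalModel x
    fun ψ hψ => (canonicalModel_eval ψ x).trans (hx ψ hψ)
  exact (canonicalModel_eval φ x).symm.trans this

end Main

theorem mainTheorem6 (m : ℕ) [m.AtLeastTwo] :
    -- strong soundness
    (∀ (Γ : Set Formula) (φ : Formula), Derives m axLID Γ φ → EntailsFid.{u} m Γ φ) ∧
    -- strong completeness
    (∀ (Γ : Set Formula) (φ : Formula), EntailsFid.{0} m Γ φ → Derives m axLID Γ φ) ∧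
    -- the canonical model is well defined, it is a model, and it satisfies (fid)
    (∀ (φ : Formula) (x y : CanWorld m axLID),
      (canonicalModel m axLID).R ⟨canProp m axLID φ, Set.mem_range_self φ⟩ x y
        = canRel m axLID φ x y) ∧
    (∀ (p : ℕ) (x : CanWorld m axLID) (a : Fin m),
      (canonicalModel m axLID).ν p x = a ↔ Formula.Jop a (Formula.var p) ∈ x.val) ∧
    (canonicalModel m axLID).IsModel ∧
    (canonicalModel m axLID).Fid := by
  exact ⟨fun _ _ h => h.entailsFid, fun _ _ h => h.derives, canonicalModel_R,
    fun p x a => x.value_eq_iff (.var p) a, isModel_canonicalModel, fid_canonicalModel⟩
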